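/- \textbf{Theorem (Reformulation with separable affine objective functions).} Let $K,M\ge 0$ and $N,H,I,J\ge 1$ be integers, let $\mathbb X\subseteq\mathbb R^K$ be closed, let $\|\cdot\|$ be a norm on $\mathbb R^M$ with dual norm $\|v\|_*=\sup_{\|u\|\le 1}\langle v,u\rangle$, and put $\|\xi\|_N=\sum_{n=1}^N\|\xi_n\|$ for $\xi=(\xi_1,\dots,\xi_N)\in(\mathbb R^M)^N$. For $n\in[N]$ let $\Xi_n=\{\xi_n\in\mathbb R^M: C_n\xi_n\le g_n\}$ be a nonempty polyhedron, where $C_n\in\mathbb R^{m_n\times M}$, $g_n\in\mathbb R^{m_n}$, and let $\Xi=\Xi_1\times\dots\times\Xi_N$. Let $$\ell(x,\xi)=\sum_{n=1}^N\max_{j\in[J]}\{\langle a_{nj}(x),\xi_n\rangle+b_{nj}(x)\},$$ where $a_{nj}(x)\in\mathbb R^M$ and $b_{nj}(x)\in\mathbb R$ are affine (in particular, possibly linear) in $x$. Let $\hat\xi^{(i)}_h=(\hat\xi^{(i)}_{h,1},\dots,\hat\xi^{(i)}_{h,N})\in(\mathbb R^M)^N$ for $h\in[H]$, $i\in[I]$,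 let $t_h\in[0,1]$ with $\sum_{h=1}^H t_h=1$, and let $\hat{\mathbb P}=\sum_{h=1}^H\sum_{i=1}^I\frac{t_h}{I}\,\delta_{\hat\xi^{(i)}_h}$. For $\epsilon\ge 0$ let $\mathbb B_\epsilon$ be the set of all probability distributions $\mathbb Q$ supported on $\Xi$ with $\mathbb E^{\mathbb Q}\|\xi\|_N<\infty$ and $d_W(\hat{\mathbb P},\mathbb Q)\le\epsilon$, where $d_W(\hat{\mathbb P},\mathbb Q)=\inf_\Pi\int\|\xi-\xi'\|_N\,\Pi(d\xi,d\xi')$, the infimum being over all joint distributions $\Pi$ with marginals $\mathbb Q$ (of $\xi$) and $\hat{\mathbb P}$ (of $\xi'$). Then for every $\epsilon\ge 0$ the MR-DRO problem $$\inf_{x\in\mathbb X}\ \sup_{\mathbb Q\in\mathbb B_\epsilon}\mathbb E^{\mathbb Q}[\ell(x,\xi)]$$ is equivalent to the finite program $$\begin{aligned}\inf_{x,\lambda,s,\gamma}\quad&\lambda\epsilon+\sum_{h=1}^H\sum_{i=1}^I\sum_{n=1}^N\frac{t_h}{I}\,s_{hin}\\ \text{s.t.}\quad& x\in\mathbb X,\\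 & b_{nj}(x)+\langle a_{nj}(x),\hat\xi^{(i)}_{h,n}\rangle+\langle\gamma_{hijn},g_n-C_n\hat\xi^{(i)}_{h,n}\rangle\le s_{hin}&&\forall h,i,j,n,\\ &\|C_n^{\mathsf T}\gamma_{hijn}-a_{nj}(x)\|_*\le\lambda&&\forall h,i,j,n,\\ &\gamma_{hijn}\ge 0&&\forall h,i,j,n,\end{aligned}$$ with $\lambda\in\mathbb R$, $s_{hin}\in\mathbb R$, $\gamma_{hijn}\in\mathbb R^{m_n}$, in the following sense: the two problems have the same optimal value in $[-\infty,\infty]$ (with $\sup\emptyset=-\infty$ and $\inf\emptyset=+\infty$); moreover, for each fixed $x\in\mathbb X$ the worst-case expectation $\sup_{\mathbb Q\in\mathbb B_\epsilon}\mathbb E^{\mathbb Q}[\ell(x,\xi)]$ equals the optimal value of the program with $x$ held fixed; and the $x$-part of every optimal solution of the program is an optimal solution of the MR-DRO problem. -/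

import Mathlib

open MeasureTheory
open scoped Matrix

/-- The data of a multi-reference distributionally robust problem with separable affine loss:
decision dimension `K`, `N` blocks of uncertain parameters in `ℝ^M`, `H` sources, `I` past events,
`J` affine pieces per block. A full parameter vector is `ξ : Fin N → Fin M → ℝ`. -/
structure MRDRO (K M N H I J : ℕ) where
  /-- the feasible set of decisions -/
  X : Set (Fin K → ℝ)
  /-- the norm on `ℝ^M` (its definiteness is a hypothesis of the theorem) -/
  nrm : Seminorm ℝ (Fin M → ℝ)
  /-- the number of inequalities describing the `n`-th uncertainty set -/
  m : Fin N → ℕ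
  /-- constraint matrices -/
  C : (n : Fin N) → Matrix (Fin (m n)) (Fin M) ℝ
  /-- constraint right-hand sides -/
  g : (n : Fin N) → Fin (m n) → ℝ
  /-- slopes of the affine pieces, as functions of the decision -/
  a : Fin N → Fin J → (Fin K → ℝ) →ᵃ[ℝ] (Fin M → ℝ)
  /-- intercepts of the affine pieces, as functions of the decision -/
  b : Fin N → Fin J → (Fin K → ℝ) →ᵃ[ℝ] ℝ
  /-- the revised prediction obtained from source `h` and past event `i` -/
  xiHat : Fin H → Fin I → Fin N → Fin M → ℝ
  /-- the trust in each source -/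
  t : Fin H → ℝ
  /-- the radius of the Wasserstein ball -/
  ε : ℝ

namespace MRDRO

variable {K M N H I J : ℕ} (D : MRDRO K M N H I J)

/-- The dual norm `‖v‖_* = sup {⟨v, u⟩ : ‖u‖ ≤ 1}`. -/
noncomputable def dualNorm (v : Fin M → ℝ) : ℝ :=
  sSup {r : ℝ | ∃ u : Fin M → ℝ, D.nrm u ≤ 1 ∧ r = v ⬝ᵥ u}

/-- The block-sum norm `‖ξ‖_N = ∑ n, ‖ξ n‖`. -/
noncomputable def blockNorm (ξ : Fin N → Fin M → ℝ) : ℝ :=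
  ∑ n, D.nrm (ξ n)

/-- The polyhedron `Ξ_n = {ξ : C_n ξ ≤ g_n}`. -/
def blockSet (n : Fin N) : Set (Fin M → ℝ) :=
  {ξ | D.C n *ᵥ ξ ≤ D.g n}

/-- The uncertainty set: the product of the `Ξ_n`. -/
def uncertaintySet : Set (Fin N → Fin M → ℝ) :=
  {ξ | ∀ n, ξ n ∈ D.blockSet n}

/-- The loss `∑ n, max_j (⟨a_nj(x), ξ_n⟩ + b_nj(x))`. -/
noncomputable def loss (x : Fin K → ℝ) (ξ : Fin N → Fin M → ℝ) : ℝ :=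
  ∑ n, ⨆ j, (D.a n j x ⬝ᵥ ξ n + D.b n j x)

/-- The reference distribution: mass `t_h / I` at each revised prediction. -/
noncomputable def reference : Measure (Fin N → Fin M → ℝ) :=
  ∑ h, ∑ i, ENNReal.ofReal (D.t h / I) • Measure.dirac (D.xiHat h i)

/-- The Wasserstein distance for the block-sum norm: the infimum of the transport cost over all
joint distributions with marginals `Q` and `P`. -/
noncomputable def wasserstein (P Q : Measure (Fin N → Fin M → ℝ)) : ENNReal :=
  ⨅ π ∈ {π : Measure ((Fin N → Fin M → ℝ) × (Fin N → Fin M → ℝ)) |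
      π.map Prod.fst = Q ∧ π.map Prod.snd = P},
    ∫⁻ z, ENNReal.ofReal (D.blockNorm (z.1 - z.2)) ∂π

/-- The ambiguity set: probability distributions on the uncertainty set with finite first moment
and Wasserstein distance at most `ε` from the reference distribution. -/
def ambiguitySet : Set (Measure (Fin N → Fin M → ℝ)) :=
  {Q | IsProbabilityMeasure Q ∧ (∀ᵐ ξ ∂Q, ξ ∈ D.uncertaintySet) ∧
    ∫⁻ ξ, ENNReal.ofReal (D.blockNorm ξ) ∂Q < ⊤ ∧
    D.wasserstein D.reference Q ≤ ENNReal.ofReal D.ε}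

/-- The worst-case expected loss of a decision. The loss grows at most linearly in `ξ`, hence is
integrable for every distribution in the ambiguity set. -/
noncomputable def worstCase (x : Fin K → ℝ) : EReal :=
  ⨆ Q ∈ D.ambiguitySet, ((∫ ξ, D.loss x ξ ∂Q : ℝ) : EReal)

/-- The variables of the finite program. -/
structure Vars where
  x : Fin K → ℝ
  lam : ℝ
  s : Fin H → Fin I → Fin N → ℝ
  γ : Fin H → Fin I → Fin J → (n : Fin N) → Fin (D.m n) → ℝ

/-- The feasible set of the finite program. -/
def feasible : Set D.Vars :=
  {v | v.x ∈ D.X ∧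
    (∀ h i j n, D.b n j v.x + D.a n j v.x ⬝ᵥ D.xiHat h i n
      + v.γ h i j n ⬝ᵥ (D.g n - D.C n *ᵥ D.xiHat h i n) ≤ v.s h i n) ∧
    (∀ h i j n, D.dualNorm ((D.C n)ᵀ *ᵥ v.γ h i j n - D.a n j v.x) ≤ v.lam) ∧
    (∀ h i j n, 0 ≤ v.γ h i j n)}

/-- The objective of the finite program. -/
noncomputable def objective (v : D.Vars) : ℝ :=
  v.lam * D.ε + ∑ h, ∑ i, ∑ n, D.t h / I * v.s h i n

end MRDRO

/-! Upper bound. For a feasible point of the program, the multipliers `γ` and the dual-norm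
constraint bound the loss on the uncertainty set by `lam` times the distance to any reference point
plus the corresponding `s` (`loss_le_of_mem_feasible`). Integrating this against a nearly optimal
coupling bounds every admissible expectation by the objective (`integral_loss_le_objective`).

Lower bound. Fix `x` and restrict to discrete transport: for each atom of positive mass and each
block, split the mass into parts `p j`, one for each affine piece, and move part `j` by `d j / p j`.
In the variables `(p, d)` the value and the polyhedral constraints are linear and the cost is a
norm. The loss and the cost are sums over blocks and the support is a product, so only block
marginals matter: blocks may be recombined independently, and every plan is dominated by the worst
case (`planValue_le_worstCase`).

Hence if the worst case is below `r`, so is every plan. The perturbed plan problem has a closed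
convex cone as its set of attainable data; separating a point from it produces `lam`, `s`, `γ`
(`exists_dual_of_planValue_lt`). Closedness replaces a Slater condition, so `ε = 0` and an empty
ambiguity set need no separate treatment. -/

/-! ### Seminorms on a finite-dimensional space. -/

/-- A seminorm on `ℝ^M` is continuous. -/
theorem Seminorm.continuous_of_pi {M : ℕ} (p : Seminorm ℝ (Fin M → ℝ)) : Continuous p :=
  continuousOn_univ.1 (p.convexOn.continuousOn isOpen_univ)

/-- A definite seminorm on `ℝ^M` dominates the sup norm. -/
theorem Seminorm.exists_norm_le_mul {M : ℕ} (p : Seminorm ℝ (Fin M → ℝ))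
    (hp : ∀ v, p v = 0 → v = 0) : ∃ R, 0 < R ∧ ∀ v, ‖v‖ ≤ R * p v := by
  -- The unit sphere is empty exactly when `M = 0`.
  rcases (Metric.sphere (0 : Fin M → ℝ) 1).eq_empty_or_nonempty with he | hn
  · refine ⟨1, one_pos, fun v => ?_⟩
    by_cases hv : v = 0
    · simp [hv]
    · have : ‖v‖⁻¹ • v ∈ Metric.sphere (0 : Fin M → ℝ) 1 := by
        simp [norm_smul, hv]
      simp [he] at this
  · obtain ⟨u, hu, hmin⟩ := (isCompact_sphere (0 : Fin M → ℝ) 1).exists_isMinOn hn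
      p.continuous_of_pi.continuousOn
    have hu1 : ‖u‖ = 1 := by simpa using hu
    have hpos : 0 < p u := by
      refine lt_of_le_of_ne (apply_nonneg p u) fun h => ?_
      have := hp u h.symm
      simp [this] at hu1
    refine ⟨(p u)⁻¹, inv_pos.2 hpos, fun v => ?_⟩
    by_cases hv : v = 0
    · simp [hv]
    have hv' : 0 < ‖v‖ := norm_pos_iff.2 hv
    have hmem : ‖v‖⁻¹ • v ∈ Metric.sphere (0 : Fin M → ℝ) 1 := by simp [norm_smul, hv]
    have h1 : p u ≤ p (‖v‖⁻¹ • v) := hmin hmem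
    rw [map_smul_eq_mul, norm_inv, norm_norm] at h1
    rw [inv_mul_eq_div] at h1 ⊢
    rw [le_div_iff₀ hv'] at h1
    rw [le_div_iff₀ hpos]
    linarith

theorem Seminorm.abs_dotProduct_le {M : ℕ} (p : Seminorm ℝ (Fin M → ℝ)) {R : ℝ}
    (hR : ∀ v, ‖v‖ ≤ R * p v) (a v : Fin M → ℝ) : |a ⬝ᵥ v| ≤ (∑ i, |a i| * R) * p v := by
  rw [Finset.sum_mul]
  refine (Finset.abs_sum_le_sum_abs _ _).trans (Finset.sum_le_sum fun i _ => ?_)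
  rw [abs_mul, mul_assoc]
  exact mul_le_mul_of_nonneg_left ((norm_le_pi_norm v i).trans (hR v)) (abs_nonneg _)

/-! ### Conic duality for transport plans. -/

section Duality

variable {β κ : Type*} [Fintype β] [Fintype κ] {M : ℕ} (nrm : Seminorm ℝ (Fin M → ℝ))
  {m : β → ℕ} (C : ∀ b, Matrix (Fin (m b)) (Fin M) ℝ) (G : ∀ b, Fin (m b) → ℝ)
  (a : β → κ → Fin M → ℝ) (c : β → κ → ℝ)

/-- The value of a plan `(p, d)` in the perspective form of the transport problem. -/
def planValue (p : β → κ → ℝ) (d : β → κ → Fin M → ℝ) : ℝ :=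
  ∑ b, ∑ j, (p b j * c b j + a b j ⬝ᵥ d b j)

/-- The transport cost of a plan. -/
def planCost (d : β → κ → Fin M → ℝ) : ℝ := ∑ b, ∑ j, nrm (d b j)

/-- The graph of the perturbed perspective problem. -/
def planGraph : Set ((ℝ × ℝ × (∀ b, κ → Fin (m b) → ℝ) × (β → ℝ)) ×
    ((β → κ → ℝ) × (β → κ → Fin M → ℝ))) :=
  {z | (∀ b j, 0 ≤ z.2.1 b j) ∧ z.1.1 ≤ planValue a c z.2.1 z.2.2 ∧
    planCost nrm z.2.2 ≤ z.1.2.1 ∧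
    (∀ b j, C b *ᵥ z.2.2 b j - z.2.1 b j • G b ≤ z.1.2.2.1 b j) ∧
    ∀ b, ∑ j, z.2.1 b j = z.1.2.2.2 b}

theorem isClosed_planGraph : IsClosed (planGraph nrm C G a c) := by
  have hn := nrm.continuous_of_pi
  simp only [planGraph, Set.ofPred_and, Set.ofPred_forall, planValue, planCost]
  refine IsClosed.inter ?_ (IsClosed.inter ?_ (IsClosed.inter ?_ (IsClosed.inter ?_ ?_)))
  · exact isClosed_iInter fun b => isClosed_iInter fun j =>
      isClosed_le continuous_const (by fun_prop)
  · exact isClosed_le (by fun_prop) (by unfold dotProduct; fun_prop)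
  · exact isClosed_le (by fun_prop) (by fun_prop)
  · refine isClosed_iInter fun b => isClosed_iInter fun j => isClosed_le
      (Continuous.sub (Continuous.matrix_mulVec continuous_const ?_) ?_) ?_ <;> fun_prop
  · refine isClosed_iInter fun b => ?_
    refine isClosed_eq (continuous_finsetSum _ fun j _ => ?_) ?_ <;> fun_prop

variable {nrm C G a c}

theorem planGraph_add {z z'} (hz : z ∈ planGraph nrm C G a c) (hz' : z' ∈ planGraph nrm C G a c) :
    z + z' ∈ planGraph nrm C G a c := by
  obtain ⟨h1, h2, h3, h4, h5⟩ := hz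
  obtain ⟨k1, k2, k3, k4, k5⟩ := hz'
  refine ⟨fun b j => add_nonneg (h1 b j) (k1 b j), ?_, ?_, fun b j => ?_, fun b => ?_⟩
  · refine (add_le_add h2 k2).trans (le_of_eq ?_)
    simp only [planValue, ← Finset.sum_add_distrib]
    refine Finset.sum_congr rfl fun b _ => Finset.sum_congr rfl fun j _ => ?_
    simp [dotProduct_add]; ring
  · refine le_trans ?_ (add_le_add h3 k3)
    simp only [planCost, ← Finset.sum_add_distrib]
    exact Finset.sum_le_sum fun b _ => Finset.sum_le_sum fun j _ => map_add_le_add nrm _ _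
  · refine le_trans (le_of_eq ?_) (add_le_add (h4 b j) (k4 b j))
    simp [Matrix.mulVec_add, add_smul]; abel
  · simp [Finset.sum_add_distrib, h5 b, k5 b]

theorem planGraph_smul {z} (hz : z ∈ planGraph nrm C G a c) {t : ℝ} (ht : 0 ≤ t) :
    t • z ∈ planGraph nrm C G a c := by
  obtain ⟨h1, h2, h3, h4, h5⟩ := hz
  refine ⟨fun b j => mul_nonneg ht (h1 b j), ?_, ?_, fun b j => ?_, fun b => ?_⟩
  · refine (mul_le_mul_of_nonneg_left h2 ht).trans (le_of_eq ?_)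
    simp only [planValue, Finset.mul_sum]
    refine Finset.sum_congr rfl fun b _ => Finset.sum_congr rfl fun j _ => ?_
    simp [dotProduct_smul]; ring
  · refine le_trans (le_of_eq ?_) (mul_le_mul_of_nonneg_left h3 ht)
    simp [planCost, Finset.mul_sum, map_smul_eq_mul, abs_of_nonneg ht]
  · refine le_trans (le_of_eq ?_) (smul_le_smul_of_nonneg_left (h4 b j) ht)
    simp [Matrix.mulVec_smul, smul_sub, smul_smul]
  · simp [← h5 b, Finset.mul_sum]

/-- Bounded data force bounded plans: the masses are nonnegative with prescribed sums, and the
displacements are controlled by the cost because `nrm` is definite. Preimages of a convergent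
sequence therefore have a convergent subsequence. -/
theorem isClosed_fst_image_planGraph (hnrm : ∀ v, nrm v = 0 → v = 0) :
    IsClosed (Prod.fst '' planGraph nrm C G a c) := by
  obtain ⟨R, hR, hRn⟩ := nrm.exists_norm_le_mul hnrm
  refine IsSeqClosed.isClosed fun z z₀ hz hlim => ?_
  choose q hq hqz using hz
  have hbdd : Bornology.IsBounded (Set.range z) := Metric.isBounded_range_of_tendsto z hlim
  obtain ⟨B, hB⟩ := isBounded_iff_forall_norm_le.1 hbdd
  have hB0 : 0 ≤ B := (norm_nonneg _).trans (hB (z 0) ⟨0, rfl⟩)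
  have hmem : ∀ k, (q k).2 ∈ Metric.closedBall
      (0 : (β → κ → ℝ) × (β → κ → Fin M → ℝ)) (max B (R * B)) := by
    intro k
    obtain ⟨h1, h2, h3, h4, h5⟩ := hq k
    have hzk : ‖z k‖ ≤ B := hB _ ⟨k, rfl⟩
    rw [hqz k] at h2 h3 h4 h5
    rw [mem_closedBall_zero_iff, Prod.norm_def]
    refine max_le_max ?_ ?_
    · refine (pi_norm_le_iff_of_nonneg hB0).2 fun b => (pi_norm_le_iff_of_nonneg hB0).2 fun j => ?_
      rw [Real.norm_of_nonneg (h1 b j)]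
      calc (q k).2.1 b j ≤ ∑ j, (q k).2.1 b j :=
            Finset.single_le_sum (fun i _ => h1 b i) (Finset.mem_univ j)
        _ = (z k).2.2.2 b := h5 b
        _ ≤ ‖(z k).2.2.2 b‖ := Real.le_norm_self _
        _ ≤ ‖(z k).2.2.2‖ := norm_le_pi_norm _ b
        _ ≤ ‖(z k).2.2‖ := norm_snd_le _
        _ ≤ ‖(z k).2‖ := norm_snd_le _
        _ ≤ ‖z k‖ := norm_snd_le _
        _ ≤ B := hzk
    · have hRB := mul_nonneg hR.le hB0
      refine (pi_norm_le_iff_of_nonneg hRB).2 fun b => (pi_norm_le_iff_of_nonneg hRB).2 fun j => ?_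
      refine (hRn _).trans (mul_le_mul_of_nonneg_left ?_ hR.le)
      calc nrm ((q k).2.2 b j) ≤ ∑ j, nrm ((q k).2.2 b j) :=
            Finset.single_le_sum (f := fun j => nrm ((q k).2.2 b j))
              (fun i _ => apply_nonneg nrm _) (Finset.mem_univ j)
        _ ≤ planCost nrm (q k).2.2 :=
            Finset.single_le_sum (f := fun b => ∑ j, nrm ((q k).2.2 b j))
              (fun i _ => Finset.sum_nonneg fun _ _ => apply_nonneg nrm _) (Finset.mem_univ b)
        _ ≤ (z k).2.1 := h3
        _ ≤ ‖(z k).2.1‖ := Real.le_norm_self _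
        _ ≤ ‖(z k).2‖ := norm_fst_le _
        _ ≤ ‖z k‖ := norm_snd_le _
        _ ≤ B := hzk
  obtain ⟨w, -, φ, hφ, hw⟩ := (isCompact_closedBall _ _).tendsto_subseq hmem
  refine ⟨(z₀, w), ?_, rfl⟩
  refine (isClosed_planGraph nrm C G a c).mem_of_tendsto
    ((hlim.comp hφ.tendsto_atTop).prodMk_nhds hw) (Filter.Eventually.of_forall fun k => ?_)
  have := hq (φ k)
  simp only [Function.comp]
  rw [← hqz (φ k)]
  exact this

/-- Hahn–Banach separation in the space of data (value, budget, constraint slack, masses). No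
feasible plan is assumed to exist, so the coefficient `α` of the value may vanish; this case is
settled by a recession argument. -/
theorem exists_dual_of_planValue_lt [Nonempty κ] (hnrm : ∀ v, nrm v = 0 → v = 0)
    {w : β → ℝ} {ε r : ℝ}
    (hlt : ∀ (p : β → κ → ℝ) (d : β → κ → Fin M → ℝ), (∀ b j, 0 ≤ p b j) →
      (∀ b, ∑ j, p b j = w b) → (∀ b j, C b *ᵥ d b j ≤ p b j • G b) → planCost nrm d ≤ ε →
      planValue a c p d < r) :
    ∃ (lam : ℝ) (s : β → ℝ) (γ : ∀ b, κ → Fin (m b) → ℝ), 0 ≤ lam ∧ (∀ b j, 0 ≤ γ b j) ∧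
      (∀ b j, c b j + γ b j ⬝ᵥ G b ≤ s b) ∧
      (∀ b j u, a b j ⬝ᵥ u - γ b j ⬝ᵥ (C b *ᵥ u) ≤ lam * nrm u) ∧
      lam * ε + ∑ b, w b * s b ≤ r := by
  classical
  have hconv : Convex ℝ (Prod.fst '' planGraph nrm C G a c) := by
    have h : Convex ℝ (planGraph nrm C G a c) := fun x hx y hy s t hs ht _ =>
      planGraph_add (planGraph_smul hx hs) (planGraph_smul hy ht)
    exact h.linear_image (LinearMap.fst ℝ _ _)
  have hnot : ((r, ε, 0, w) : ℝ × ℝ × (∀ b, κ → Fin (m b) → ℝ) × (β → ℝ)) ∉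
      Prod.fst '' planGraph nrm C G a c := by
    rintro ⟨⟨-, p, d⟩, ⟨h1, h2, h3, h4, h5⟩, rfl⟩
    exact absurd h2 (not_le.2 (hlt p d h1 h5 (fun b j => by simpa using h4 b j) h3))
  obtain ⟨f, u, hfu, hur⟩ := geometric_hahn_banach_closed_point hconv
    (isClosed_fst_image_planGraph hnrm) hnot
  have h0 : (0 : _) ∈ planGraph nrm C G a c := by
    refine ⟨fun b j => le_rfl, ?_, ?_, ?_, ?_⟩ <;> simp [planValue, planCost]
  have hu0 : 0 < u := by simpa using hfu 0 ⟨0, h0, rfl⟩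
  -- A linear functional bounded above on a cone is nonpositive there.
  have hf0 : ∀ z ∈ planGraph nrm C G a c, f z.1 ≤ 0 := by
    intro z hz
    by_contra! hpos
    have := hfu _ ⟨_, planGraph_smul hz (t := u / f z.1) (by positivity), rfl⟩
    rw [Prod.smul_fst, map_smul, smul_eq_mul, div_mul_cancel₀ _ hpos.ne'] at this
    exact lt_irrefl _ this
  -- coefficients of the separating functional
  set α : ℝ := f (1, 0, 0, 0) with hα
  set lam : ℝ := -f (0, 1, 0, 0) with hlam
  let γ : ∀ b, κ → Fin (m b) → ℝ := fun b j i =>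
    -f (0, 0, Pi.single b (Pi.single j (Pi.single i 1)), 0)
  let s : β → ℝ := fun b => -f (0, 0, 0, Pi.single b 1)
  have hγdot : ∀ b j y, f (0, 0, Pi.single b (Pi.single j y), 0) = -(γ b j ⬝ᵥ y) := by
    intro b j y
    let g : (Fin (m b) → ℝ) →ₗ[ℝ] ℝ := f.toLinearMap ∘ₗ LinearMap.inr ℝ ℝ _ ∘ₗ
      LinearMap.inr ℝ ℝ _ ∘ₗ LinearMap.inl ℝ _ (β → ℝ) ∘ₗ
      LinearMap.single ℝ (fun b => κ → Fin (m b) → ℝ) b ∘ₗ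
      LinearMap.single ℝ (fun _ : κ => Fin (m b) → ℝ) j
    have hg : ∀ y, g y = f (0, 0, Pi.single b (Pi.single j y), 0) := fun y => rfl
    rw [← hg, LinearMap.pi_apply_eq_sum_univ g y]
    simp only [dotProduct, γ, ← hg, smul_eq_mul, neg_mul, Finset.sum_neg_distrib, neg_neg]
    refine Finset.sum_congr rfl fun i _ => ?_
    rw [mul_comm]
    congr 2
    ext k
    simp [Pi.single_apply, eq_comm]
  have hsσ : ∀ σ : β → ℝ, f (0, 0, 0, σ) = -∑ b, σ b * s b := by
    intro σ
    let g : (β → ℝ) →ₗ[ℝ] ℝ := f.toLinearMap ∘ₗ LinearMap.inr ℝ ℝ _ ∘ₗ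
      LinearMap.inr ℝ ℝ _ ∘ₗ LinearMap.inr ℝ (∀ b, κ → Fin (m b) → ℝ) (β → ℝ)
    have hg : ∀ y, g y = f (0, 0, 0, y) := fun y => rfl
    rw [← hg, LinearMap.pi_apply_eq_sum_univ g σ]
    simp only [s, ← hg, smul_eq_mul, mul_neg, Finset.sum_neg_distrib, neg_neg]
    refine Finset.sum_congr rfl fun i _ => ?_
    congr 2
    ext k
    simp [Pi.single_apply, eq_comm]
  have hsplit : ∀ v e y σ, f (v, e, y, σ) = α * v - lam * e + f (0, 0, y, 0) + f (0, 0, 0, σ) := by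
    intro v e y σ
    have : ((v, e, y, σ) : ℝ × ℝ × (∀ b, κ → Fin (m b) → ℝ) × (β → ℝ)) =
        v • (1, 0, 0, 0) + e • (0, 1, 0, 0) + (0, 0, y, 0) + (0, 0, 0, σ) := by
      simp
    rw [this, map_add, map_add, map_add, map_smul, map_smul, ← hα, hlam, smul_eq_mul, smul_eq_mul]
    ring
  have hα0 : 0 ≤ α := by
    have : ((-1, 0, 0, 0), 0) ∈ planGraph nrm C G a c := by
      refine ⟨fun b j => le_rfl, ?_, ?_, ?_, ?_⟩ <;> simp [planValue, planCost]
    have := hf0 _ this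
    simp only at this
    rw [hsplit, hsσ] at this
    simpa using this
  have hlam0 : 0 ≤ lam := by
    have : ((0, 1, 0, 0), 0) ∈ planGraph nrm C G a c := by
      refine ⟨fun b j => le_rfl, ?_, ?_, ?_, ?_⟩ <;> simp [planValue, planCost]
    have := hf0 _ this
    simp only at this
    rw [hsplit, hsσ] at this
    simpa using this
  have hγ0 : ∀ b j, 0 ≤ γ b j := by
    intro b j i
    have : ((0, 0, Pi.single b (Pi.single j (Pi.single i 1)), 0), 0) ∈ planGraph nrm C G a c := by
      refine ⟨fun b j => le_rfl, ?_, ?_, fun b' j' => ?_, ?_⟩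
      · simp [planValue]
      · simp [planCost]
      · have h0 : (0 : ∀ b, κ → Fin (m b) → ℝ) ≤ Pi.single b (Pi.single j (Pi.single i 1)) :=
          Pi.single_nonneg.2 (Pi.single_nonneg.2 (Pi.single_nonneg.2 zero_le_one))
        simpa using h0 b' j'
      · simp
    have := hf0 _ this
    simpa [γ] using this
  -- Test the functional on plans with a single nonzero entry. Then `t = 1`, `v = 0` gives the
  -- intercept constraint, and `t = 0` (displacement without mass) gives the slope constraint.
  have hmain : ∀ b j (t : ℝ) (v : Fin M → ℝ), 0 ≤ t →
      α * (t * c b j + a b j ⬝ᵥ v) - lam * nrm v - γ b j ⬝ᵥ (C b *ᵥ v - t • G b) - t * s b ≤ 0 := by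
    intro b j t v ht
    have hv : planValue a c (Pi.single b (Pi.single j t)) (Pi.single b (Pi.single j v)) =
        t * c b j + a b j ⬝ᵥ v := by
      unfold planValue
      rw [Finset.sum_eq_single b, Finset.sum_eq_single j]
      · simp
      · intro j' _ hj'; simp [hj']
      · simp
      · intro b' _ hb'; simp [hb']
      · simp
    have hc : planCost nrm (Pi.single b (Pi.single j v) : β → κ → Fin M → ℝ) = nrm v := by
      unfold planCost
      rw [Finset.sum_eq_single b, Finset.sum_eq_single j]
      · simp
      · intro j' _ hj'; simp [hj']
      · simp
      · intro b' _ hb'; simp [hb']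
      · simp
    have hmem : ((t * c b j + a b j ⬝ᵥ v, nrm v,
        Pi.single b (Pi.single j (C b *ᵥ v - t • G b)), Pi.single b t),
        (Pi.single b (Pi.single j t), Pi.single b (Pi.single j v))) ∈ planGraph nrm C G a c := by
      refine ⟨fun b' j' => ?_, hv.ge, hc.le, fun b' j' => ?_, fun b' => ?_⟩
      · have h0 : (0 : β → κ → ℝ) ≤ Pi.single b (Pi.single j t) :=
          Pi.single_nonneg.2 (Pi.single_nonneg.2 ht)
        exact h0 b' j'
      · by_cases hb : b' = b
        · subst hb
          by_cases hj : j' = j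
          · subst hj; simp
          · simp [hj]
        · simp [hb]
      · by_cases hb : b' = b
        · subst hb; simp
        · simp [hb]
    have := hf0 _ hmem
    simp only at this
    rw [hsplit, hγdot, hsσ, Finset.sum_eq_single b (by intro b' _ hb'; simp [hb']) (by simp)] at this
    simp only [Pi.single_eq_same] at this
    linarith
  have hA : ∀ b j, α * c b j + γ b j ⬝ᵥ G b ≤ s b := by
    intro b j
    have := hmain b j 1 0 zero_le_one
    simp at this
    linarith
  have hB : ∀ b j v, α * (a b j ⬝ᵥ v) - γ b j ⬝ᵥ (C b *ᵥ v) ≤ lam * nrm v := by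
    intro b j v
    have := hmain b j 0 v le_rfl
    simp at this
    linarith
  have hobj : lam * ε + ∑ b, w b * s b < α * r := by
    have := hu0.trans hur
    rw [hsplit, hsσ, hsσ w] at this
    simp only [Pi.zero_apply, zero_mul, Finset.sum_const_zero, neg_zero, add_zero] at this
    linarith
  rcases hα0.eq_or_lt with hz | hpos
  · -- a direction of recession along which the dual objective decreases
    obtain ⟨R, hR, hRn⟩ := nrm.exists_norm_le_mul hnrm
    rw [← hz, zero_mul] at hobj
    set δ := -(lam * ε + ∑ b, w b * s b) with hδ
    have hδ0 : 0 < δ := by linarith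
    -- With zero multipliers, `lam₀` and `s₀` always form a dual feasible point: norm equivalence
    -- bounds all slopes at once.
    let lam₀ : ℝ := ∑ b, ∑ j, ∑ i, |a b j i| * R
    have hnn : ∀ b j, 0 ≤ ∑ i, |a b j i| * R := fun b j =>
      Finset.sum_nonneg fun i _ => mul_nonneg (abs_nonneg _) hR.le
    have hlam₀ : 0 ≤ lam₀ := Finset.sum_nonneg fun b _ => Finset.sum_nonneg fun j _ => hnn b j
    let s₀ : β → ℝ := fun b => Finset.univ.sup' Finset.univ_nonempty (c b)
    set o := lam₀ * ε + ∑ b, w b * s₀ b with ho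
    -- Going `t` steps along the recession direction lowers the objective from `o` to `o - t * δ`,
    -- which is then at most `r`.
    set t := max 0 ((o - r) / δ) with ht
    have ht0 : 0 ≤ t := le_max_left _ _
    refine ⟨lam₀ + t * lam, fun b => s₀ b + t * s b, fun b j => t • γ b j,
      add_nonneg hlam₀ (mul_nonneg ht0 hlam0), fun b j => smul_nonneg ht0 (hγ0 b j),
      fun b j => ?_, fun b j v => ?_, ?_⟩
    · have h1 := hA b j
      rw [← hz, zero_mul, zero_add] at h1
      have h2 : c b j ≤ s₀ b := Finset.le_sup' (c b) (Finset.mem_univ j)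
      rw [smul_dotProduct, smul_eq_mul]
      exact add_le_add h2 (mul_le_mul_of_nonneg_left h1 ht0)
    · have h1 := hB b j v
      rw [← hz, zero_mul, zero_sub] at h1
      have h2 : a b j ⬝ᵥ v ≤ lam₀ * nrm v := by
        calc a b j ⬝ᵥ v ≤ (∑ i, |a b j i| * R) * nrm v :=
              (le_abs_self _).trans (nrm.abs_dotProduct_le hRn _ _)
          _ ≤ lam₀ * nrm v := by
              refine mul_le_mul_of_nonneg_right ?_ (apply_nonneg nrm v)
              exact (Finset.single_le_sum (fun j _ => hnn b j) (Finset.mem_univ j)).trans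
                (Finset.single_le_sum (f := fun b => ∑ j, ∑ i, |a b j i| * R)
                  (fun b _ => Finset.sum_nonneg fun j _ => hnn b j) (Finset.mem_univ b))
      rw [smul_dotProduct, smul_eq_mul]
      have := mul_le_mul_of_nonneg_left h1 ht0
      linarith
    · have h1 : (o - r) / δ ≤ t := le_max_right _ _
      rw [div_le_iff₀ hδ0] at h1
      have h2 : ∑ b, w b * (s₀ b + t * s b) = ∑ b, w b * s₀ b + t * ∑ b, w b * s b := by
        rw [Finset.mul_sum, ← Finset.sum_add_distrib]
        exact Finset.sum_congr rfl fun b _ => by ring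
      rw [h2]
      have h3 : t * δ = -(t * lam * ε + t * ∑ b, w b * s b) := by rw [hδ]; ring
      linarith
  · refine ⟨α⁻¹ * lam, fun b => α⁻¹ * s b, fun b j => α⁻¹ • γ b j,
      mul_nonneg (inv_nonneg.2 hα0) hlam0,
      fun b j => smul_nonneg (inv_nonneg.2 hα0) (hγ0 b j), fun b j => ?_, fun b j v => ?_, ?_⟩
    · have h1 := mul_le_mul_of_nonneg_left (hA b j) (inv_nonneg.2 hα0)
      rw [mul_add, inv_mul_cancel_left₀ hpos.ne'] at h1
      rwa [smul_dotProduct, smul_eq_mul]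
    · have h1 := mul_le_mul_of_nonneg_left (hB b j v) (inv_nonneg.2 hα0)
      rw [mul_sub, inv_mul_cancel_left₀ hpos.ne'] at h1
      rwa [smul_dotProduct, smul_eq_mul, mul_assoc]
    · have h1 := mul_le_mul_of_nonneg_left hobj.le (inv_nonneg.2 hα0)
      rw [inv_mul_cancel_left₀ hpos.ne', mul_add, Finset.mul_sum] at h1
      refine le_trans (le_of_eq ?_) h1
      rw [mul_assoc]
      congr 1
      exact Finset.sum_congr rfl fun b _ => by ring

end Duality

/-! ### Finitely supported measures. -/

section Discrete

variable {ι X Y : Type*} [Fintype ι] [MeasurableSpace X] [MeasurableSpace Y]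

/-- The discrete measure with mass `W k` at `z k`. -/
noncomputable def discreteMeasure (W : ι → ℝ) (z : ι → X) : Measure X :=
  ∑ k, ENNReal.ofReal (W k) • Measure.dirac (z k)

theorem lintegral_discreteMeasure [MeasurableSingletonClass X] (W : ι → ℝ) (z : ι → X)
    (f : X → ENNReal) :
    ∫⁻ x, f x ∂discreteMeasure W z = ∑ k, ENNReal.ofReal (W k) * f (z k) := by
  simp [discreteMeasure, lintegral_finsetSum_measure, lintegral_smul_measure]

theorem lintegral_ofReal_discreteMeasure [MeasurableSingletonClass X] {W : ι → ℝ}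
    (hW : ∀ k, 0 ≤ W k) (z : ι → X) {f : X → ℝ} (hf : ∀ x, 0 ≤ f x) :
    ∫⁻ x, ENNReal.ofReal (f x) ∂discreteMeasure W z = ENNReal.ofReal (∑ k, W k * f (z k)) := by
  rw [lintegral_discreteMeasure, ENNReal.ofReal_sum_of_nonneg fun k _ => mul_nonneg (hW k) (hf _)]
  exact Finset.sum_congr rfl fun k _ => (ENNReal.ofReal_mul (hW k)).symm

theorem integrable_discreteMeasure [MeasurableSingletonClass X] (W : ι → ℝ) (z : ι → X)
    (f : X → ℝ) : Integrable f (discreteMeasure W z) :=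
  integrable_finsetSum_measure.2 fun _ _ =>
    (integrable_dirac (by simp)).smul_measure ENNReal.ofReal_ne_top

theorem integral_discreteMeasure [MeasurableSingletonClass X] {W : ι → ℝ} (hW : ∀ k, 0 ≤ W k)
    (z : ι → X) (f : X → ℝ) : ∫ x, f x ∂discreteMeasure W z = ∑ k, W k * f (z k) := by
  rw [discreteMeasure, integral_finsetSum_measure fun _ _ =>
    (integrable_dirac (by simp)).smul_measure ENNReal.ofReal_ne_top]
  simp [integral_smul_measure, ENNReal.toReal_ofReal, hW]

theorem map_discreteMeasure (W : ι → ℝ) (z : ι → X) {f : X → Y} (hf : Measurable f) :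
    (discreteMeasure W z).map f = discreteMeasure W (f ∘ z) := by
  rw [discreteMeasure, Measure.map_finset_sum' hf.aemeasurable]
  simp [discreteMeasure, Measure.map_smul, Measure.map_dirac' hf]

theorem isProbabilityMeasure_discreteMeasure {W : ι → ℝ} (hW : ∀ k, 0 ≤ W k)
    (hsum : ∑ k, W k = 1) (z : ι → X) : IsProbabilityMeasure (discreteMeasure W z) := by
  constructor
  simp only [discreteMeasure, Measure.coe_finsetSum, Finset.sum_apply, Measure.smul_apply,
    measure_univ, smul_eq_mul, mul_one]
  rw [← ENNReal.ofReal_sum_of_nonneg fun k _ => hW k, hsum, ENNReal.ofReal_one]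

theorem ae_discreteMeasure [MeasurableSingletonClass X] {W : ι → ℝ} {z : ι → X} {P : X → Prop}
    (h : ∀ k, P (z k)) : ∀ᵐ x ∂discreteMeasure W z, P x := by
  rw [ae_iff]
  simp only [discreteMeasure, Measure.coe_finsetSum, Finset.sum_apply, Measure.smul_apply]
  refine Finset.sum_eq_zero fun k _ => ?_
  simp [Measure.dirac_apply, h k]

end Discrete

/-! ### Dual norm, block norm and loss. -/

namespace MRDRO

variable {K M N H I J : ℕ} {D : MRDRO K M N H I J}

theorem bddAbove_dualNorm (hnrm : ∀ v, D.nrm v = 0 → v = 0) (v : Fin M → ℝ) :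
    BddAbove {r : ℝ | ∃ u : Fin M → ℝ, D.nrm u ≤ 1 ∧ r = v ⬝ᵥ u} := by
  obtain ⟨R, hR, hRn⟩ := D.nrm.exists_norm_le_mul hnrm
  refine ⟨∑ i, |v i| * R, ?_⟩
  rintro _ ⟨u, hu, rfl⟩
  refine ((le_abs_self _).trans (D.nrm.abs_dotProduct_le hRn v u)).trans ?_
  exact mul_le_of_le_one_right
    (Finset.sum_nonneg fun i _ => mul_nonneg (abs_nonneg _) hR.le) hu

theorem dualNorm_nonneg (hnrm : ∀ v, D.nrm v = 0 → v = 0) (v : Fin M → ℝ) :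
    0 ≤ D.dualNorm v :=
  le_csSup (bddAbove_dualNorm hnrm v) ⟨0, by simp⟩

theorem dotProduct_le_dualNorm_mul (hnrm : ∀ v, D.nrm v = 0 → v = 0) (v u : Fin M → ℝ) :
    v ⬝ᵥ u ≤ D.dualNorm v * D.nrm u := by
  by_cases hu : D.nrm u = 0
  · simp [hnrm u hu]
  have hpos : 0 < D.nrm u := lt_of_le_of_ne (apply_nonneg _ _) (Ne.symm hu)
  have : v ⬝ᵥ ((D.nrm u)⁻¹ • u) ≤ D.dualNorm v :=
    le_csSup (bddAbove_dualNorm hnrm v) ⟨_, by simp [map_smul_eq_mul, abs_of_pos hpos, hu], rfl⟩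
  rw [dotProduct_smul, smul_eq_mul, inv_mul_eq_div, div_le_iff₀ hpos] at this
  exact this

theorem dualNorm_le {v : Fin M → ℝ} {r : ℝ} (hr : 0 ≤ r) (h : ∀ u, v ⬝ᵥ u ≤ r * D.nrm u) :
    D.dualNorm v ≤ r := by
  refine csSup_le ⟨0, 0, by simp⟩ ?_
  rintro _ ⟨u, hu, rfl⟩
  exact (h u).trans (mul_le_of_le_one_right hr hu)

theorem continuous_blockNorm : Continuous D.blockNorm := by
  have := D.nrm.continuous_of_pi
  unfold blockNorm
  fun_prop

theorem blockNorm_nonneg (ξ : Fin N → Fin M → ℝ) : 0 ≤ D.blockNorm ξ :=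
  Finset.sum_nonneg fun _ _ => apply_nonneg _ _

theorem blockNorm_sub_le (ξ ζ ρ : Fin N → Fin M → ℝ) :
    D.blockNorm (ξ - ρ) ≤ D.blockNorm (ξ - ζ) + D.blockNorm (ζ - ρ) := by
  simp only [blockNorm, ← Finset.sum_add_distrib]
  refine Finset.sum_le_sum fun n _ => ?_
  have : (ξ - ρ) n = (ξ - ζ) n + (ζ - ρ) n := by simp
  rw [this]
  exact map_add_le_add _ _ _

theorem continuous_loss [Nonempty (Fin J)] (x : Fin K → ℝ) : Continuous (D.loss x) := by
  unfold loss
  refine continuous_finsetSum _ fun n _ => ?_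
  simp only [← Finset.sup'_univ_eq_ciSup]
  refine Continuous.finset_sup'_apply _ fun j _ => ?_
  unfold dotProduct
  fun_prop

theorem reference_eq_discreteMeasure : D.reference =
    discreteMeasure (fun k : Fin H × Fin I => D.t k.1 / I) (fun k => D.xiHat k.1 k.2) := by
  simp only [reference, discreteMeasure, Fintype.sum_prod_type]

/-! ### Weak duality. -/

section Weak

variable (hnrm : ∀ v, D.nrm v = 0 → v = 0)
include hnrm

theorem loss_le_of_mem_feasible [Nonempty (Fin J)] {v : D.Vars} (hv : v ∈ D.feasible)
    {ξ : Fin N → Fin M → ℝ} (hξ : ξ ∈ D.uncertaintySet) (h : Fin H) (i : Fin I) :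
    D.loss v.x ξ ≤ v.lam * D.blockNorm (ξ - D.xiHat h i) + ∑ n, v.s h i n := by
  obtain ⟨-, h1, h2, h3⟩ := hv
  rw [loss, blockNorm, Finset.mul_sum, ← Finset.sum_add_distrib]
  refine Finset.sum_le_sum fun n _ => ciSup_le fun j => ?_
  have k1 := h1 h i j n
  have k2 := (dotProduct_le_dualNorm_mul hnrm ((D.C n)ᵀ *ᵥ v.γ h i j n - D.a n j v.x)
    -- The minus sign matches the order `Cᵀγ - a` inside the dual norm.
    (-(ξ n - D.xiHat h i n))).trans
    (mul_le_mul_of_nonneg_right (h2 h i j n) (apply_nonneg _ _))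
  rw [map_neg_eq_map, dotProduct_neg, sub_dotProduct, Matrix.mulVec_transpose,
    ← Matrix.dotProduct_mulVec, Matrix.mulVec_sub, dotProduct_sub, dotProduct_sub] at k2
  have k3 : v.γ h i j n ⬝ᵥ (D.C n *ᵥ ξ n) ≤ v.γ h i j n ⬝ᵥ D.g n :=
    dotProduct_le_dotProduct_of_nonneg_left (hξ n) (h3 h i j n)
  rw [dotProduct_sub] at k1
  have : (ξ - D.xiHat h i) n = ξ n - D.xiHat h i n := rfl
  rw [this]
  linarith

theorem integrable_dotProduct {Q : Measure (Fin N → Fin M → ℝ)}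
    (hQ : ∫⁻ ξ, ENNReal.ofReal (D.blockNorm ξ) ∂Q < ⊤) (a : Fin M → ℝ) (n : Fin N) :
    Integrable (fun ξ : Fin N → Fin M → ℝ => a ⬝ᵥ ξ n) Q := by
  obtain ⟨R, hR, hRn⟩ := D.nrm.exists_norm_le_mul hnrm
  have hint : Integrable D.blockNorm Q :=
    ⟨continuous_blockNorm.aestronglyMeasurable,
      (hasFiniteIntegral_iff_ofReal (ae_of_all _ blockNorm_nonneg)).2 hQ⟩
  refine (hint.const_mul (∑ i, |a i| * R)).mono' ?_ (ae_of_all _ fun ξ => ?_)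
  · refine Continuous.aestronglyMeasurable ?_
    unfold dotProduct
    fun_prop
  · refine (D.nrm.abs_dotProduct_le hRn a (ξ n)).trans ?_
    refine mul_le_mul_of_nonneg_left ?_
      (Finset.sum_nonneg fun i _ => mul_nonneg (abs_nonneg _) hR.le)
    exact Finset.single_le_sum (f := fun n => D.nrm (ξ n)) (fun _ _ => apply_nonneg _ _)
      (Finset.mem_univ n)

theorem integral_loss_le_objective [Nonempty (Fin N)] [Nonempty (Fin I)] [Nonempty (Fin J)]
    [Nonempty (Fin H)] (ht : ∀ h, 0 ≤ D.t h) (hε : 0 ≤ D.ε) {v : D.Vars} (hv : v ∈ D.feasible)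
    {Q : Measure (Fin N → Fin M → ℝ)} (hQ : Q ∈ D.ambiguitySet) :
    ∫ ξ, D.loss v.x ξ ∂Q ≤ D.objective v := by
  obtain ⟨hprob, hsupp, hmom, hW⟩ := hQ
  have hlam : 0 ≤ v.lam := (dualNorm_nonneg hnrm _).trans
    (hv.2.2.1 (Classical.arbitrary _) (Classical.arbitrary _) (Classical.arbitrary _)
      (Classical.arbitrary _))
  have hw : ∀ k : Fin H × Fin I, 0 ≤ D.t k.1 / I := fun k =>
    div_nonneg (ht _) (Nat.cast_nonneg _)
  -- The lower envelope of the cones `∑ s + lam * ‖ζ - ξ̂‖` extends the atomwise bounds to a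
  -- continuous function on the whole space. The coupling can then be integrated without
  -- disintegration, and coinciding atoms cause no ambiguity.
  let S : (Fin N → Fin M → ℝ) → ℝ := fun ζ =>
    Finset.univ.inf' Finset.univ_nonempty fun k : Fin H × Fin I =>
      (∑ n, v.s k.1 k.2 n) + v.lam * D.blockNorm (ζ - D.xiHat k.1 k.2)
  have hbn := continuous_blockNorm (D := D)
  have hScont : Continuous S := by
    refine Continuous.finset_inf'_apply _ fun k _ => ?_
    fun_prop
  have hpt : ∀ ξ ∈ D.uncertaintySet, ∀ ζ,
      D.loss v.x ξ ≤ v.lam * D.blockNorm (ξ - ζ) + S ζ := by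
    intro ξ hξ ζ
    rw [← sub_le_iff_le_add']
    refine Finset.le_inf' _ _ fun k _ => ?_
    have h1 := loss_le_of_mem_feasible hnrm hv hξ k.1 k.2
    have h2 := mul_le_mul_of_nonneg_left (blockNorm_sub_le (D := D) ξ ζ (D.xiHat k.1 k.2)) hlam
    linarith
  have hS : ∀ k : Fin H × Fin I, S (D.xiHat k.1 k.2) ≤ ∑ n, v.s k.1 k.2 n := by
    intro k
    refine (Finset.inf'_le _ (Finset.mem_univ k)).trans (le_of_eq ?_)
    simp [blockNorm]
  have hSint : ∫ ζ, S ζ ∂D.reference ≤ ∑ h, ∑ i, ∑ n, D.t h / I * v.s h i n := by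
    rw [reference_eq_discreteMeasure, integral_discreteMeasure hw, Fintype.sum_prod_type]
    refine Finset.sum_le_sum fun h _ => Finset.sum_le_sum fun i _ => ?_
    rw [← Finset.mul_sum]
    exact mul_le_mul_of_nonneg_left (hS (h, i)) (hw (h, i))
  -- The slack `η` avoids having to show that an optimal coupling exists.
  have key : ∀ η : ℝ, 0 < η → ∫ ξ, D.loss v.x ξ ∂Q ≤ D.objective v + v.lam * η := by
    intro η hη
    have hlt : D.wasserstein D.reference Q < ENNReal.ofReal (D.ε + η) :=
      hW.trans_lt ((ENNReal.ofReal_lt_ofReal_iff (by linarith)).2 (by linarith))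
    simp only [wasserstein, iInf_lt_iff] at hlt
    obtain ⟨π, ⟨hfst, hsnd⟩, hcost⟩ := hlt
    have hcint : Integrable (fun z : (Fin N → Fin M → ℝ) × (Fin N → Fin M → ℝ) =>
        D.blockNorm (z.1 - z.2)) π :=
      ⟨(hbn.comp (continuous_fst.sub continuous_snd)).aestronglyMeasurable,
        (hasFiniteIntegral_iff_ofReal (ae_of_all _ fun z => blockNorm_nonneg _)).2
          (hcost.trans ENNReal.ofReal_lt_top)⟩
    have hcle : ∫ z, D.blockNorm (z.1 - z.2) ∂π ≤ D.ε + η := by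
      rw [integral_eq_lintegral_of_nonneg_ae (ae_of_all _ fun z => blockNorm_nonneg _)
        hcint.aestronglyMeasurable]
      exact ENNReal.toReal_le_of_le_ofReal (by linarith) hcost.le
    have hSi : Integrable (fun z : (Fin N → Fin M → ℝ) × (Fin N → Fin M → ℝ) => S z.2) π := by
      have : Integrable S (π.map Prod.snd) := by
        rw [hsnd, reference_eq_discreteMeasure]
        exact integrable_discreteMeasure _ _ _
      exact this.comp_measurable measurable_snd
    have hSe : ∫ z, S z.2 ∂π = ∫ ζ, S ζ ∂D.reference := by
      rw [← hsnd, integral_map measurable_snd.aemeasurable hScont.aestronglyMeasurable]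
    have hle : ∀ᵐ z ∂π, D.loss v.x z.1 ≤ v.lam * D.blockNorm (z.1 - z.2) + S z.2 := by
      have : ∀ᵐ ξ ∂π.map Prod.fst, ξ ∈ D.uncertaintySet := by rw [hfst]; exact hsupp
      filter_upwards [ae_of_ae_map measurable_fst.aemeasurable this] with z hz
      exact hpt _ hz _
    -- One fixed affine piece per block gives an integrable minorant; with the majorant from `hle`
    -- it makes the loss integrable, so the Bochner integral is not the default `0`.
    let j₀ : Fin J := Classical.arbitrary _
    have hlow : Integrable (fun ξ : Fin N → Fin M → ℝ =>
        ∑ n, (D.a n j₀ v.x ⬝ᵥ ξ n + D.b n j₀ v.x)) Q :=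
      integrable_finsetSum _ fun n _ =>
        (integrable_dotProduct hnrm hmom _ n).add (integrable_const _)
    have hlow' : Integrable (fun z : (Fin N → Fin M → ℝ) × (Fin N → Fin M → ℝ) =>
        ∑ n, (D.a n j₀ v.x ⬝ᵥ z.1 n + D.b n j₀ v.x)) π := by
      rw [← hfst] at hlow
      exact hlow.comp_measurable measurable_fst
    have hup : Integrable (fun z : (Fin N → Fin M → ℝ) × (Fin N → Fin M → ℝ) =>
        v.lam * D.blockNorm (z.1 - z.2) + S z.2) π := (hcint.const_mul _).add hSi
    have hli : Integrable (fun z : (Fin N → Fin M → ℝ) × (Fin N → Fin M → ℝ) =>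
        D.loss v.x z.1) π := by
      refine integrable_of_le_of_le
        ((continuous_loss v.x).comp continuous_fst).aestronglyMeasurable
        (ae_of_all _ fun z => ?_) hle hlow' hup
      exact Finset.sum_le_sum fun n _ =>
        le_ciSup (f := fun j => D.a n j v.x ⬝ᵥ z.1 n + D.b n j v.x) (Finite.bddAbove_range _) j₀
    calc ∫ ξ, D.loss v.x ξ ∂Q = ∫ z, D.loss v.x z.1 ∂π := by
          rw [← hfst, integral_map measurable_fst.aemeasurable
            (continuous_loss v.x).aestronglyMeasurable]
      _ ≤ ∫ z, (v.lam * D.blockNorm (z.1 - z.2) + S z.2) ∂π := integral_mono_ae hli hup hle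
      _ = v.lam * ∫ z, D.blockNorm (z.1 - z.2) ∂π + ∫ ζ, S ζ ∂D.reference := by
          rw [integral_add (hcint.const_mul _) hSi, integral_const_mul, hSe]
      _ ≤ v.lam * (D.ε + η) + ∑ h, ∑ i, ∑ n, D.t h / I * v.s h i n :=
          add_le_add (mul_le_mul_of_nonneg_left hcle hlam) hSint
      _ = D.objective v + v.lam * η := by rw [objective]; ring
  refine le_of_forall_pos_le_add fun δ hδ => ?_
  -- The `+ 1` covers `lam = 0`.
  refine (key (δ / (v.lam + 1)) (by positivity)).trans (add_le_add le_rfl ?_)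
  rw [mul_div_assoc', div_le_iff₀ (by positivity)]
  nlinarith

end Weak

end MRDRO

/-! ### Marginals of a product of weights. -/

/-- `F` is absorbed into the `n`-th factor; the sum of products then factors, and all other factors
sum to `1`. -/
theorem sum_pi_prod_mul {N J : ℕ} {q : Fin N → Fin J → ℝ} (hq : ∀ n, ∑ j, q n j = 1)
    (n : Fin N) (F : Fin J → ℝ) :
    ∑ f : Fin N → Fin J, (∏ n, q n (f n)) * F (f n) = ∑ j, q n j * F j := by
  have h1 : ∀ f : Fin N → Fin J, (∏ n, q n (f n)) * F (f n) =
      ∏ n', q n' (f n') * (if n' = n then F (f n') else 1) := by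
    intro f
    rw [Finset.prod_mul_distrib, Finset.prod_ite_eq' Finset.univ n (fun n' => F (f n'))]
    simp
  simp only [h1]
  rw [← Fintype.piFinset_univ,
    ← Finset.prod_univ_sum (fun _ => Finset.univ)
      (fun n' j => q n' j * (if n' = n then F j else 1)),
    Finset.prod_eq_single n]
  · simp
  · intro n' _ hn'
    simp [hn', hq]
  · simp

theorem sum_pi_prod {N J : ℕ} {q : Fin N → Fin J → ℝ} (hq : ∀ n, ∑ j, q n j = 1) :
    ∑ f : Fin N → Fin J, ∏ n, q n (f n) = 1 := by
  rw [← Fintype.piFinset_univ, ← Finset.prod_univ_sum (fun _ => Finset.univ) q]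
  simp [hq]

/-! ### From plans to distributions. -/

namespace MRDRO

variable {K M N H I J : ℕ} {D : MRDRO K M N H I J}

section Plan

variable {ι : Type*} [Fintype ι] {W : ι → ℝ} {ζ : ι → Fin N → Fin M → ℝ}

/-- Given its atom, each block chooses its piece independently with probabilities `p / W`, and the
atom moves by `d / p` in that block. Dividing the constraint by `p` shows that the new point lies in
the support. The value is only a lower bound, since the chosen piece need not attain the maximum. -/
theorem planValue_le_worstCase_of_pos
    (href : D.reference = discreteMeasure W ζ)
    (hW : ∀ k, 0 < W k) (hWsum : ∑ k, W k = 1) (x : Fin K → ℝ)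
    {p : ι × Fin N → Fin J → ℝ} {d : ι × Fin N → Fin J → Fin M → ℝ}
    (hp : ∀ b j, 0 < p b j) (hsum : ∀ b, ∑ j, p b j = W b.1)
    (hC : ∀ b j, D.C b.2 *ᵥ d b j ≤ p b j • (D.g b.2 - D.C b.2 *ᵥ ζ b.1 b.2))
    (hcost : planCost D.nrm d ≤ D.ε) :
    ((planValue (fun b j => D.a b.2 j x) (fun b j => D.b b.2 j x + D.a b.2 j x ⬝ᵥ ζ b.1 b.2) p d
      : ℝ) : EReal) ≤ D.worstCase x := by
  let q : ι → Fin N → Fin J → ℝ := fun k n j => p (k, n) j / W k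
  have hq : ∀ k n, ∑ j, q k n j = 1 := fun k n => by
    simp only [q, ← Finset.sum_div, hsum (k, n), div_self (hW k).ne']
  let V : ι × (Fin N → Fin J) → ℝ := fun k => W k.1 * ∏ n, q k.1 n (k.2 n)
  have hV : ∀ k, 0 ≤ V k := fun k => mul_nonneg (hW _).le
    (Finset.prod_nonneg fun n _ => div_nonneg (hp _ _).le (hW _).le)
  let z : ι × (Fin N → Fin J) → Fin N → Fin M → ℝ := fun k n =>
    ζ k.1 n + (p (k.1, n) (k.2 n))⁻¹ • d (k.1, n) (k.2 n)
  -- Block-separable sums see only the block marginals `p`; cost and value are both of this kind.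
  have hmarg : ∀ F : ι × Fin N → Fin J → ℝ,
      ∑ k, V k * ∑ n, F (k.1, n) (k.2 n) = ∑ b, ∑ j, p b j * F b j := by
    intro F
    rw [Fintype.sum_prod_type, Fintype.sum_prod_type]
    refine Finset.sum_congr rfl fun k _ => ?_
    simp only [V, Finset.mul_sum]
    rw [Finset.sum_comm]
    refine Finset.sum_congr rfl fun n _ => ?_
    simp only [mul_assoc]
    rw [← Finset.mul_sum, sum_pi_prod_mul (hq k) n (F (k, n)), Finset.mul_sum]
    refine Finset.sum_congr rfl fun j _ => ?_
    rw [← mul_assoc, mul_div_cancel₀ _ (hW k).ne']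
  have hVk : ∀ k, ∑ f, V (k, f) = W k := fun k => by
    simp only [V]
    rw [← Finset.mul_sum, sum_pi_prod (hq k), mul_one]
  have hVsum : ∑ k, V k = 1 := by
    rw [Fintype.sum_prod_type, ← hWsum]
    exact Finset.sum_congr rfl fun k _ => hVk k
  have hmem : discreteMeasure V z ∈ D.ambiguitySet := by
    refine ⟨isProbabilityMeasure_discreteMeasure hV hVsum z, ae_discreteMeasure fun k n => ?_,
      ?_, ?_⟩
    · have h1 := smul_le_smul_of_nonneg_left (hC (k.1, n) (k.2 n))
        (inv_nonneg.2 (hp (k.1, n) (k.2 n)).le)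
      rw [smul_smul, inv_mul_cancel₀ (hp _ _).ne', one_smul] at h1
      change D.C n *ᵥ z k n ≤ D.g n
      simp only [z]
      rw [Matrix.mulVec_add, Matrix.mulVec_smul]
      exact le_sub_iff_add_le'.1 h1
    · rw [lintegral_ofReal_discreteMeasure hV z blockNorm_nonneg]
      exact ENNReal.ofReal_lt_top
    · let π := discreteMeasure V fun k => (z k, ζ k.1)
      have hfst : π.map Prod.fst = discreteMeasure V z :=
        map_discreteMeasure _ _ measurable_fst
      have hsnd : π.map Prod.snd = D.reference := by
        rw [href, map_discreteMeasure _ _ measurable_snd]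
        simp only [discreteMeasure, Fintype.sum_prod_type, Function.comp]
        refine Finset.sum_congr rfl fun k _ => ?_
        rw [← Finset.sum_smul, ← ENNReal.ofReal_sum_of_nonneg fun f _ => hV (k, f), hVk]
      refine (iInf₂_le π ⟨hfst, hsnd⟩).trans ?_
      rw [show π = discreteMeasure V fun k => (z k, ζ k.1) from rfl,
        lintegral_ofReal_discreteMeasure (X := (Fin N → Fin M → ℝ) × (Fin N → Fin M → ℝ))
        (f := fun y => D.blockNorm (y.1 - y.2)) hV _
        fun y => blockNorm_nonneg _]
      refine ENNReal.ofReal_le_ofReal (le_trans (le_of_eq ?_) hcost)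
      have h1 := hmarg fun b j => D.nrm ((p b j)⁻¹ • d b j)
      simp only [blockNorm]
      have h2 : ∀ k n, (z k - ζ k.1) n = (p (k.1, n) (k.2 n))⁻¹ • d (k.1, n) (k.2 n) :=
        fun k n => by simp [z]
      simp only [h2]
      rw [h1, planCost]
      refine Finset.sum_congr rfl fun b _ => Finset.sum_congr rfl fun j _ => ?_
      rw [map_smul_eq_mul, Real.norm_of_nonneg (inv_nonneg.2 (hp b j).le),
        mul_inv_cancel_left₀ (hp b j).ne']
  refine le_trans (EReal.coe_le_coe_iff.2 ?_)
    (le_iSup₂ (f := fun Q _ => ((∫ ξ, D.loss x ξ ∂Q : ℝ) : EReal)) _ hmem)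
  rw [integral_discreteMeasure hV]
  have h1 := hmarg fun b j =>
    D.a b.2 j x ⬝ᵥ (ζ b.1 b.2 + (p b j)⁻¹ • d b j) + D.b b.2 j x
  calc planValue (fun b j => D.a b.2 j x) (fun b j => D.b b.2 j x + D.a b.2 j x ⬝ᵥ ζ b.1 b.2) p d
      = ∑ b, ∑ j, p b j * (D.a b.2 j x ⬝ᵥ (ζ b.1 b.2 + (p b j)⁻¹ • d b j) + D.b b.2 j x) := by
        refine Finset.sum_congr rfl fun b _ => Finset.sum_congr rfl fun j _ => ?_
        have := (hp b j).ne'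
        rw [dotProduct_add, dotProduct_smul, smul_eq_mul]
        field_simp
        ring
    _ = _ := h1.symm
    _ ≤ ∑ k, V k * D.loss x (z k) := by
        refine Finset.sum_le_sum fun k _ => mul_le_mul_of_nonneg_left ?_ (hV k)
        exact Finset.sum_le_sum fun n _ =>
          le_ciSup (f := fun j => D.a n j x ⬝ᵥ z k n + D.b n j x) (Finite.bddAbove_range _) (k.2 n)

/-- A part with `p = 0` and `d ≠ 0` is displacement carrying no mass, realized only in the limit:
mix in a strictly positive plan with weight `η` and let `η → 0`. -/
theorem planValue_le_worstCase [Nonempty (Fin J)]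
    (href : D.reference = discreteMeasure W ζ)
    (hW : ∀ k, 0 < W k) (hWsum : ∑ k, W k = 1) (x : Fin K → ℝ)
    {p : ι × Fin N → Fin J → ℝ} {d : ι × Fin N → Fin J → Fin M → ℝ}
    (hp : ∀ b j, 0 ≤ p b j) (hsum : ∀ b, ∑ j, p b j = W b.1)
    (hC : ∀ b j, D.C b.2 *ᵥ d b j ≤ p b j • (D.g b.2 - D.C b.2 *ᵥ ζ b.1 b.2))
    (hcost : planCost D.nrm d ≤ D.ε) :
    ((planValue (fun b j => D.a b.2 j x) (fun b j => D.b b.2 j x + D.a b.2 j x ⬝ᵥ ζ b.1 b.2) p d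
      : ℝ) : EReal) ≤ D.worstCase x := by
  set a : ι × Fin N → Fin J → Fin M → ℝ := fun b j => D.a b.2 j x
  set c : ι × Fin N → Fin J → ℝ := fun b j => D.b b.2 j x + D.a b.2 j x ⬝ᵥ ζ b.1 b.2
  have hJ : (0 : ℝ) < J := by
    have : 0 < Fintype.card (Fin J) := Fintype.card_pos
    rw [Fintype.card_fin] at this
    exact_mod_cast this
  -- Averaging the plan over `j` makes all masses positive, keeps the summed constraints, and by the
  -- triangle inequality does not raise the cost.
  let p' : ι × Fin N → Fin J → ℝ := fun b _ => (J : ℝ)⁻¹ * W b.1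
  let d' : ι × Fin N → Fin J → Fin M → ℝ := fun b _ => (J : ℝ)⁻¹ • ∑ j, d b j
  have hC' : ∀ b j, D.C b.2 *ᵥ d' b j ≤ p' b j • (D.g b.2 - D.C b.2 *ᵥ ζ b.1 b.2) := by
    intro b j
    simp only [d', p', Matrix.mulVec_smul, mul_smul, Matrix.mulVec_sum]
    refine smul_le_smul_of_nonneg_left ?_ (inv_nonneg.2 hJ.le)
    rw [← hsum b, Finset.sum_smul]
    exact Finset.sum_le_sum fun j _ => hC b j
  have hcost' : planCost D.nrm d' ≤ planCost D.nrm d := by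
    refine Finset.sum_le_sum fun b _ => ?_
    simp only [d', map_smul_eq_mul, Real.norm_of_nonneg (inv_nonneg.2 hJ.le), Finset.sum_const,
      Finset.card_univ, Fintype.card_fin, nsmul_eq_mul]
    rw [mul_inv_cancel_left₀ hJ.ne']
    exact Finset.le_sum_of_subadditive D.nrm (map_zero _).le (map_add_le_add _) _ _
  have key : ∀ η : ℝ, 0 < η → η ≤ 1 →
      (((1 - η) * planValue a c p d + η * planValue a c p' d' : ℝ) : EReal) ≤ D.worstCase x := by
    intro η hη hη1
    have h1η : 0 ≤ 1 - η := by linarith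
    have := planValue_le_worstCase_of_pos href hW hWsum x
      (p := fun b j => (1 - η) * p b j + η * p' b j)
      (d := fun b j => (1 - η) • d b j + η • d' b j) ?_ ?_ ?_ ?_
    · refine le_trans (le_of_eq ?_) this
      congr 1
      simp only [planValue, Finset.mul_sum, ← Finset.sum_add_distrib]
      refine Finset.sum_congr rfl fun b _ => Finset.sum_congr rfl fun j _ => ?_
      simp only [a, c, dotProduct_add, dotProduct_smul, smul_eq_mul]
      ring
    · intro b j
      have : 0 < p' b j := mul_pos (inv_pos.2 hJ) (hW _)
      have := mul_nonneg h1η (hp b j)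
      positivity
    · intro b
      rw [Finset.sum_add_distrib, ← Finset.mul_sum, ← Finset.mul_sum, hsum]
      simp only [p', Finset.sum_const, Finset.card_univ, Fintype.card_fin, nsmul_eq_mul]
      rw [mul_inv_cancel_left₀ hJ.ne']
      ring
    · intro b j
      rw [Matrix.mulVec_add, Matrix.mulVec_smul, Matrix.mulVec_smul, add_smul, mul_smul, mul_smul]
      exact add_le_add (smul_le_smul_of_nonneg_left (hC b j) h1η)
        (smul_le_smul_of_nonneg_left (hC' b j) hη.le)
    · have h1 : planCost D.nrm (fun b j => (1 - η) • d b j + η • d' b j) ≤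
          (1 - η) * planCost D.nrm d + η * planCost D.nrm d' := by
        simp only [planCost, Finset.mul_sum, ← Finset.sum_add_distrib]
        refine Finset.sum_le_sum fun b _ => Finset.sum_le_sum fun j _ => ?_
        refine (map_add_le_add _ _ _).trans (le_of_eq ?_)
        rw [map_smul_eq_mul, map_smul_eq_mul, Real.norm_of_nonneg h1η, Real.norm_of_nonneg hη.le]
      have h2 := mul_le_mul_of_nonneg_left (hcost'.trans hcost) hη.le
      have h3 := mul_le_mul_of_nonneg_left hcost h1η
      linarith
  have hlim : Filter.Tendsto
      (fun η : ℝ => (((1 - η) * planValue a c p d + η * planValue a c p' d' : ℝ) : EReal))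
      (nhdsWithin 0 (Set.Ioi 0)) (nhds ((planValue a c p d : ℝ) : EReal)) := by
    refine ((continuous_coe_real_ereal.tendsto _).comp ?_)
    have : Continuous fun η : ℝ => (1 - η) * planValue a c p d + η * planValue a c p' d' := by
      fun_prop
    have := this.tendsto 0
    simp only [sub_zero, one_mul, zero_mul, add_zero] at this
    exact this.mono_left nhdsWithin_le_nhds
  refine le_of_tendsto hlim ?_
  filter_upwards [Ioc_mem_nhdsGT (zero_lt_one (α := ℝ))] with η hη
  exact key η hη.1 hη.2

end Plan

/-! ### Strong duality for a fixed decision. -/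

-- Plans need positive weights, so duality is applied to the atoms with mass only. The dual-norm and
-- sign constraints involve the block but not the atom, so multipliers can be copied to massless
-- atoms, whose `s` has weight zero in the objective.
open Classical in
theorem exists_feasible_of_worstCase_lt [Nonempty (Fin J)]
    (hI : 0 < I) (hnrm : ∀ v, D.nrm v = 0 → v = 0)
    (ht : ∀ h, 0 ≤ D.t h) (htsum : ∑ h, D.t h = 1)
    {x : Fin K → ℝ} (hx : x ∈ D.X) {r : ℝ} (hr : D.worstCase x < r) :
    ∃ v ∈ D.feasible, v.x = x ∧ D.objective v ≤ r := by
  have hI' : (0 : ℝ) < I := by exact_mod_cast hI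
  let P : Fin H × Fin I → Prop := fun k => 0 < D.t k.1 / I
  let W : {k // P k} → ℝ := fun k => D.t k.1.1 / I
  let ζ : {k // P k} → Fin N → Fin M → ℝ := fun k => D.xiHat k.1.1 k.1.2
  have hnP : ∀ k, ¬ P k → D.t k.1 / I = 0 := fun k hk =>
    le_antisymm (not_lt.1 hk) (div_nonneg (ht _) hI'.le)
  have href : D.reference = discreteMeasure W ζ := by
    rw [reference_eq_discreteMeasure]
    simp only [discreteMeasure]
    rw [← Fintype.sum_subtype_add_sum_subtype P]
    rw [Finset.sum_eq_zero (s := (Finset.univ : Finset {k // ¬ P k})), add_zero]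
    intro k _
    rw [hnP k.1 k.2, ENNReal.ofReal_zero, zero_smul]
  have hsub : ∀ F : Fin H × Fin I → ℝ, (∀ k, ¬ P k → F k = 0) →
      ∑ h, ∑ i, F (h, i) = ∑ k : {k // P k}, F k := by
    intro F hF
    rw [← Fintype.sum_prod_type, ← Fintype.sum_subtype_add_sum_subtype P]
    exact add_eq_left.2 (Finset.sum_eq_zero fun k _ => hF k.1 k.2)
  have hWsum : ∑ k, W k = 1 := by
    rw [← hsub (fun k => D.t k.1 / I) hnP, ← htsum]
    refine Finset.sum_congr rfl fun h _ => ?_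
    simp only [Finset.sum_const, Finset.card_univ, Fintype.card_fin, nsmul_eq_mul]
    exact mul_div_cancel₀ _ hI'.ne'
  obtain ⟨k₀⟩ : Nonempty {k // P k} := by
    by_contra hne
    rw [not_nonempty_iff] at hne
    simp at hWsum
  obtain ⟨lam, s, γ, hlam, hγ, hs, hdual, hobj⟩ := exists_dual_of_planValue_lt (nrm := D.nrm)
    (β := {k // P k} × Fin N) (κ := Fin J) (m := fun b => D.m b.2)
    (C := fun b => D.C b.2) (G := fun b => D.g b.2 - D.C b.2 *ᵥ ζ b.1 b.2)
    (a := fun b j => D.a b.2 j x) (c := fun b j => D.b b.2 j x + D.a b.2 j x ⬝ᵥ ζ b.1 b.2)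
    (w := fun b => W b.1) (ε := D.ε) (r := r) hnrm fun p d h1 h2 h3 h4 => by
      have := (planValue_le_worstCase href (fun k => k.2) hWsum x h1 h2 h3 h4).trans_lt hr
      exact EReal.coe_lt_coe_iff.1 this
  -- indices without mass reuse the multipliers of an index with mass
  let γ' : Fin H → Fin I → Fin J → (n : Fin N) → Fin (D.m n) → ℝ := fun h i j n =>
    if hP : P (h, i) then γ (⟨(h, i), hP⟩, n) j else γ (k₀, n) j
  have hγ' : ∀ h i j n, ∃ k, γ' h i j n = γ (k, n) j := by
    intro h i j n
    by_cases hP : P (h, i)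
    · exact ⟨_, dif_pos hP⟩
    · exact ⟨_, dif_neg hP⟩
  let F : Fin H → Fin I → Fin N → Fin J → ℝ := fun h i n j =>
    D.b n j x + D.a n j x ⬝ᵥ D.xiHat h i n + γ' h i j n ⬝ᵥ (D.g n - D.C n *ᵥ D.xiHat h i n)
  let s' : Fin H → Fin I → Fin N → ℝ := fun h i n =>
    Finset.univ.sup' Finset.univ_nonempty (F h i n)
  refine ⟨⟨x, lam, s', γ'⟩, ⟨hx, fun h i j n => ?_, fun h i j n => ?_, fun h i j n => ?_⟩, rfl, ?_⟩
  · exact Finset.le_sup' (F h i n) (Finset.mem_univ j)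
  · obtain ⟨k, hk⟩ := hγ' h i j n
    simp only [hk]
    refine dualNorm_le hlam fun u => ?_
    have := hdual (k, n) j (-u)
    simp only [Matrix.mulVec_neg, dotProduct_neg, map_neg_eq_map] at this
    rw [sub_dotProduct, Matrix.mulVec_transpose, ← Matrix.dotProduct_mulVec]
    linarith
  · obtain ⟨k, hk⟩ := hγ' h i j n
    simp only [hk]
    exact hγ (k, n) j
  · refine le_trans (add_le_add le_rfl ?_) hobj
    have hfac : ∀ h i, ∑ n, D.t h / I * s' h i n = D.t h / I * ∑ n, s' h i n := fun h i =>
      (Finset.mul_sum _ _ _).symm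
    simp only [hfac]
    rw [hsub (fun k => D.t k.1 / I * ∑ n, s' k.1 k.2 n)
      (fun k hk => by rw [hnP k hk, zero_mul]), Fintype.sum_prod_type]
    refine Finset.sum_le_sum fun k _ => ?_
    rw [Finset.mul_sum]
    refine Finset.sum_le_sum fun n _ => mul_le_mul_of_nonneg_left ?_ k.2.le
    refine Finset.sup'_le _ _ fun j _ => ?_
    have : γ' k.1.1 k.1.2 j n = γ (k, n) j := dif_pos k.2
    simp only [F, this]
    exact hs (k, n) j

end MRDRO

/-! ### Assembly of weak and strong duality. -/

theorem mainTheorem3 {K M N H I J : ℕ} (hN : 0 < N) (hI : 0 < I) (hJ : 0 < J)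
    (D : MRDRO K M N H I J)
    (hX : IsClosed D.X)
    (hnrm : ∀ v, D.nrm v = 0 → v = 0)
    (hne : ∀ n, (D.blockSet n).Nonempty)
    (ht : ∀ h, 0 ≤ D.t h ∧ D.t h ≤ 1) (htsum : ∑ h, D.t h = 1)
    (hε : 0 ≤ D.ε) :
    -- the MR-DRO problem and the finite program have the same optimal value
    (⨅ x ∈ D.X, D.worstCase x) = (⨅ v ∈ D.feasible, (D.objective v : EReal)) ∧
    -- this already holds for each fixed decision
    (∀ x ∈ D.X, D.worstCase x =
      ⨅ v ∈ {v | v ∈ D.feasible ∧ v.x = x}, (D.objective v : EReal)) ∧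
    -- optimal solutions of the finite program yield optimal decisions
    (∀ v ∈ D.feasible, IsMinOn D.objective D.feasible v → IsMinOn D.worstCase D.X v.x) := by
  have : Nonempty (Fin N) := ⟨⟨0, hN⟩⟩
  have : Nonempty (Fin I) := ⟨⟨0, hI⟩⟩
  have : Nonempty (Fin J) := ⟨⟨0, hJ⟩⟩
  have : Nonempty (Fin H) := by
    by_contra hne
    rw [not_nonempty_iff] at hne
    simp at htsum
  have ht0 : ∀ h, 0 ≤ D.t h := fun h => (ht h).1
  have hweak : ∀ v ∈ D.feasible, D.worstCase v.x ≤ (D.objective v : EReal) := fun v hv =>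
    iSup₂_le fun Q hQ => EReal.coe_le_coe_iff.2
      (D.integral_loss_le_objective hnrm ht0 hε hv hQ)
  have hfix : ∀ x ∈ D.X, D.worstCase x =
      ⨅ v ∈ {v | v ∈ D.feasible ∧ v.x = x}, (D.objective v : EReal) := by
    intro x hx
    refine le_antisymm (le_iInf₂ fun v hv => hv.2 ▸ hweak v hv.1) ?_
    by_contra! hlt
    -- A real `r` strictly inside the gap also covers a worst case of `-∞`.
    obtain ⟨r, hr1, hr2⟩ := EReal.lt_iff_exists_real_btwn.1 hlt
    obtain ⟨v, hv, hvx, hobj⟩ :=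
      MRDRO.exists_feasible_of_worstCase_lt hI hnrm ht0 htsum hx hr1
    exact absurd ((iInf₂_le v ⟨hv, hvx⟩).trans (EReal.coe_le_coe_iff.2 hobj)) (not_le.2 hr2)
  refine ⟨le_antisymm ?_ ?_, hfix, ?_⟩
  · exact le_iInf₂ fun v hv => (iInf₂_le v.x hv.1).trans (hweak v hv)
  · refine le_iInf₂ fun x hx => ?_
    rw [hfix x hx]
    exact le_iInf₂ fun v hv => iInf₂_le v hv.1
  · intro v hv hmin x hx
    change D.worstCase v.x ≤ D.worstCase x
    rw [hfix x hx]
    exact le_iInf₂ fun v' hv' => (hweak v hv).trans (EReal.coe_le_coe_iff.2 (hmin hv'.1))
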